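/- Let $\mathcal P(\mathbb N)/\mathrm{Fin}$ be the quotient of the Boolean algebra of all subsets of $\mathbb N$ by the ideal of finite sets, and write $[A]$ for the class of $A\subseteq\mathbb N$. An automorphism of $\mathcal P(\mathbb N)/\mathrm{Fin}$ is *trivial* if it has the form $[A]\mapsto[f[A]]$ for some bijection $f$ between two cofinite subsets of $\mathbb N$. It is *rotary* if $f$ can be taken to be a permutation of $\mathbb N$ for which there is a sequence $(n_k)_{k\in\mathbb N}$ of positive integers such that $f$ cyclically permutes each of the consecutive intervals $I_k=\big[\sum_{i<k}n_i,\sum_{i\le k}n_i\big)$: $f(i)=i+1$ for $i\in I_k$, $i\ne\max I_k$, and $f(\max I_k)=\min I_k$. Given an automorphism $\gamma$ of $\mathcal P(\mathbb N)/\mathrm{Fin}$ and an element $d$ with $\gamma(d)=d$, the restriction $\gamma\restriction d$ is the automorphism $x\mapsto\gamma(x)$ of the Boolean algebra $\{x : x\le d\}$. Automorphisms $\alpha$ of a Boolean algebra $\mathbb A$ and $\beta$ of a Boolean algebra $\mathbb B$ are *conjugate* if there is an isomorphism $\varphi:\mathbb A\to\mathbb B$ with $\varphi\circ\alpha=\beta\circ\varphi$.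 **Corollary.** There is a set $\mathcal G$ of rotary (hence trivial) automorphisms of $\mathcal P(\mathbb N)/\mathrm{Fin}$, of cardinality $2^{\aleph_0}$, with the following two properties. 1. If the Continuum Hypothesis holds, then for all $\gamma,\gamma'\in\mathcal G$ (possibly equal), every $d\neq 0$ with $\gamma(d)=d$ and every $d'\ne 0$ with $\gamma'(d')=d'$, the restrictions $\gamma\restriction d$ and $\gamma'\restriction d'$ are conjugate. 2. If all automorphisms of $\mathcal P(\mathbb N)/\mathrm{Fin}$ are trivial, then for all distinct $\gamma,\gamma'\in\mathcal G$, every $d\neq 0$ with $\gamma(d)=d$ and every $d'\ne 0$ with $\gamma'(d')=d'$, the restrictions $\gamma\restriction d$ and $\gamma'\restriction d'$ are not conjugate. -/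

import Mathlib

namespace PModFin

/-- `A =* B`: the sets `A` and `B` differ by finitely many elements. -/
def almostEq (X : Type*) : Setoid (Set X) where
  r A B := (A \ B).Finite ∧ (B \ A).Finite
  iseqv :=
    { refl := fun A => by simp
      symm := fun h => ⟨h.2, h.1⟩
      trans := fun {A B C} h k =>
        ⟨(h.1.union k.1).subset (fun x hx => by
            by_cases hB : x ∈ B
            · exact Or.inr ⟨hB, hx.2⟩
            · exact Or.inl ⟨hx.1, hB⟩),
          (k.2.union h.2).subset (fun x hx => by
            by_cases hB : x ∈ B
            · exact Or.inr ⟨hB, hx.2⟩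
            · exact Or.inl ⟨hx.1, hB⟩)⟩ }

/-- The quotient `P(X)/Fin` of the power set of `X` by the ideal of finite sets. -/
def PFin (X : Type*) : Type _ := Quotient (almostEq X)

variable {X : Type*}

/-- The class `[A]` of a set `A` in `P(X)/Fin`. -/
def cls (A : Set X) : PFin X := Quotient.mk (almostEq X) A

/-- `[A] ≤ [B]` iff `B` contains all but finitely many members of `A`. -/
instance : LE (PFin X) where
  le a b := Quotient.liftOn₂ a b (fun A B => (A \ B).Finite) (by
    intro A B A' B' hA hB
    refine propext ⟨fun h => ?_, fun h => ?_⟩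
    · refine ((hA.2.union h).union hB.1).subset (fun x hx => ?_)
      by_cases h1 : x ∈ A
      · by_cases h2 : x ∈ B
        · exact Or.inr ⟨h2, hx.2⟩
        · exact Or.inl (Or.inr ⟨h1, h2⟩)
      · exact Or.inl (Or.inl ⟨hx.1, h1⟩)
    · refine ((hA.1.union h).union hB.2).subset (fun x hx => ?_)
      by_cases h1 : x ∈ A'
      · by_cases h2 : x ∈ B'
        · exact Or.inr ⟨h2, hx.2⟩
        · exact Or.inl (Or.inr ⟨h1, h2⟩)
      · exact Or.inl (Or.inl ⟨hx.1, h1⟩))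

theorem cls_le_cls {A B : Set X} : cls A ≤ cls B ↔ (A \ B).Finite := Iff.rfl

theorem cls_eq_cls {A B : Set X} : cls A = cls B ↔ (A \ B).Finite ∧ (B \ A).Finite :=
  ⟨fun h => Quotient.exact h, fun h => Quotient.sound (s := almostEq X) h⟩

theorem cls_surj (a : PFin X) : ∃ A : Set X, cls A = a := Quotient.exists_rep a

instance : PartialOrder (PFin X) where
  le_refl a := by
    obtain ⟨A, rfl⟩ := cls_surj a
    simp [cls_le_cls]
  le_trans a b c := by
    obtain ⟨A, rfl⟩ := cls_surj a
    obtain ⟨B, rfl⟩ := cls_surj b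
    obtain ⟨C, rfl⟩ := cls_surj c
    simp only [cls_le_cls]
    intro h k
    refine (h.union k).subset (fun x hx => ?_)
    by_cases hB : x ∈ B
    · exact Or.inr ⟨hB, hx.2⟩
    · exact Or.inl ⟨hx.1, hB⟩
  le_antisymm a b := by
    obtain ⟨A, rfl⟩ := cls_surj a
    obtain ⟨B, rfl⟩ := cls_surj b
    exact fun h k => cls_eq_cls.2 ⟨h, k⟩

/-- The Boolean operations of `P(X)/Fin` are induced by those of the power set of `X`. -/
instance : BooleanAlgebra (PFin X) where
  sup := Quotient.map₂ (· ∪ ·) (fun A A' hA B B' hB =>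
    ⟨(hA.1.union hB.1).subset (by
        rintro x ⟨h | h, hx⟩
        · exact Or.inl ⟨h, fun k => hx (Or.inl k)⟩
        · exact Or.inr ⟨h, fun k => hx (Or.inr k)⟩),
      (hA.2.union hB.2).subset (by
        rintro x ⟨h | h, hx⟩
        · exact Or.inl ⟨h, fun k => hx (Or.inl k)⟩
        · exact Or.inr ⟨h, fun k => hx (Or.inr k)⟩)⟩)
  inf := Quotient.map₂ (· ∩ ·) (fun A A' hA B B' hB =>
    ⟨(hA.1.union hB.1).subset (by
        rintro x ⟨⟨h, k⟩, hx⟩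
        by_cases hx' : x ∈ A'
        · exact Or.inr ⟨k, fun l => hx ⟨hx', l⟩⟩
        · exact Or.inl ⟨h, hx'⟩),
      (hA.2.union hB.2).subset (by
        rintro x ⟨⟨h, k⟩, hx⟩
        by_cases hx' : x ∈ A
        · exact Or.inr ⟨k, fun l => hx ⟨hx', l⟩⟩
        · exact Or.inl ⟨h, hx'⟩)⟩)
  compl := Quotient.map (fun A => Aᶜ) (fun A A' hA =>
    ⟨hA.2.subset (fun x hx => ⟨not_not.1 hx.2, hx.1⟩),
      hA.1.subset (fun x hx => ⟨not_not.1 hx.2, hx.1⟩)⟩)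
  top := cls Set.univ
  bot := cls ∅
  le_sup_left a b := by
    obtain ⟨A, rfl⟩ := cls_surj a
    obtain ⟨B, rfl⟩ := cls_surj b
    refine (cls_le_cls (A := A) (B := A ∪ B)).2 (Set.finite_empty.subset ?_)
    rintro x ⟨h, k⟩
    exact k (Or.inl h)
  le_sup_right a b := by
    obtain ⟨A, rfl⟩ := cls_surj a
    obtain ⟨B, rfl⟩ := cls_surj b
    refine (cls_le_cls (A := B) (B := A ∪ B)).2 (Set.finite_empty.subset ?_)
    rintro x ⟨h, k⟩
    exact k (Or.inr h)
  sup_le a b c := by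
    obtain ⟨A, rfl⟩ := cls_surj a
    obtain ⟨B, rfl⟩ := cls_surj b
    obtain ⟨C, rfl⟩ := cls_surj c
    intro h k
    refine (cls_le_cls (A := A ∪ B) (B := C)).2
      (((cls_le_cls.1 h).union (cls_le_cls.1 k)).subset ?_)
    rintro x ⟨l | l, hx⟩
    · exact Or.inl ⟨l, hx⟩
    · exact Or.inr ⟨l, hx⟩
  inf_le_left a b := by
    obtain ⟨A, rfl⟩ := cls_surj a
    obtain ⟨B, rfl⟩ := cls_surj b
    refine (cls_le_cls (A := A ∩ B) (B := A)).2 (Set.finite_empty.subset ?_)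
    rintro x ⟨h, k⟩
    exact k h.1
  inf_le_right a b := by
    obtain ⟨A, rfl⟩ := cls_surj a
    obtain ⟨B, rfl⟩ := cls_surj b
    refine (cls_le_cls (A := A ∩ B) (B := B)).2 (Set.finite_empty.subset ?_)
    rintro x ⟨h, k⟩
    exact k h.2
  le_inf a b c := by
    obtain ⟨A, rfl⟩ := cls_surj a
    obtain ⟨B, rfl⟩ := cls_surj b
    obtain ⟨C, rfl⟩ := cls_surj c
    intro h k
    refine (cls_le_cls (A := A) (B := B ∩ C)).2
      (((cls_le_cls.1 h).union (cls_le_cls.1 k)).subset ?_)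
    rintro x ⟨l, hx⟩
    by_cases hB : x ∈ B
    · exact Or.inr ⟨l, fun m => hx ⟨hB, m⟩⟩
    · exact Or.inl ⟨l, hB⟩
  le_sup_inf a b c := by
    obtain ⟨A, rfl⟩ := cls_surj a
    obtain ⟨B, rfl⟩ := cls_surj b
    obtain ⟨C, rfl⟩ := cls_surj c
    refine (cls_le_cls (A := (A ∪ B) ∩ (A ∪ C)) (B := A ∪ (B ∩ C))).2
      (Set.finite_empty.subset ?_)
    rintro x ⟨⟨h | h, k | k⟩, hx⟩
    · exact hx (Or.inl h)
    · exact hx (Or.inl h)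
    · exact hx (Or.inl k)
    · exact hx (Or.inr ⟨h, k⟩)
  inf_compl_le_bot a := by
    obtain ⟨A, rfl⟩ := cls_surj a
    refine (cls_le_cls (A := A ∩ Aᶜ) (B := ∅)).2 (Set.finite_empty.subset ?_)
    rintro x ⟨h, k⟩
    exact h.2 h.1
  top_le_sup_compl a := by
    obtain ⟨A, rfl⟩ := cls_surj a
    refine (cls_le_cls (A := Set.univ) (B := A ∪ Aᶜ)).2 (Set.finite_empty.subset ?_)
    rintro x ⟨h, k⟩
    exact k (Classical.em (x ∈ A))
  le_top a := by
    obtain ⟨A, rfl⟩ := cls_surj a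
    refine (cls_le_cls (A := A) (B := Set.univ)).2 (Set.finite_empty.subset ?_)
    rintro x ⟨h, k⟩
    exact k trivial
  bot_le a := by
    obtain ⟨A, rfl⟩ := cls_surj a
    refine (cls_le_cls (A := ∅) (B := A)).2 (Set.finite_empty.subset ?_)
    rintro x ⟨h, k⟩
    exact h

/-- Isomorphisms of Boolean algebras are exactly the order isomorphisms, so an automorphism of
`P(X)/Fin` is an order isomorphism of `P(X)/Fin` onto itself. -/
abbrev AutPFin (X : Type*) : Type _ := PFin X ≃o PFin X

/-- An almost permutation of `X`: a bijection between two cofinite subsets of `X`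
(the source and the target of `f`). -/
def IsAlmostPerm (f : PartialEquiv X X) : Prop :=
  f.sourceᶜ.Finite ∧ f.targetᶜ.Finite

/-- `γ = α_f`, that is, `γ [A] = [f[A]]` for every `A ⊆ X`. -/
def IsInducedBy (γ : AutPFin X) (f : PartialEquiv X X) : Prop :=
  ∀ A : Set X, γ (cls A) = cls (f '' (A ∩ f.source))

/-- An automorphism of `P(X)/Fin` is trivial if it is induced by an almost permutation. -/
def IsTrivialAut (γ : AutPFin X) : Prop :=
  ∃ f : PartialEquiv X X, IsAlmostPerm f ∧ IsInducedBy γ f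

/-- The left end point `n 0 + ⋯ + n (k - 1)` of the `k`-th interval
`I_k = [n 0 + ⋯ + n (k - 1), n 0 + ⋯ + n k)`. -/
def blockStart (n : ℕ → ℕ) (k : ℕ) : ℕ := ∑ i ∈ Finset.range k, n i

/-- `r = r_n`: the permutation `r` of `ℕ` cyclically permutes each of the consecutive intervals
`I_k` of length `n k`, sending `i` to `i + 1` unless `i = max I_k`, and `max I_k` to `min I_k`.
The intervals cover `ℕ` when all `n k` are positive, so this determines `r`. -/
def IsRotaryPermOf (n : ℕ → ℕ) (r : Equiv.Perm ℕ) : Prop :=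
  ∀ k j : ℕ, j < n k → r (blockStart n k + j) = blockStart n k + (j + 1) % n k

/-- An automorphism of `P(ℕ)/Fin` is rotary if it is induced by a rotary permutation of `ℕ`. -/
def IsRotaryAut (γ : AutPFin ℕ) : Prop :=
  ∃ (n : ℕ → ℕ) (r : Equiv.Perm ℕ),
    (∀ k, 0 < n k) ∧ IsRotaryPermOf n r ∧ IsInducedBy γ r.toPartialEquiv

/-- The restriction of an automorphism `γ` of a Boolean algebra to a `γ`-invariant element `d`:
the automorphism `x ↦ γ x` of the relative algebra `{x | x ≤ d}`. -/
def restrictAut {A : Type*} [BooleanAlgebra A] (γ : A ≃o A) (d : A) (hd : γ d = d) :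
    Set.Iic d ≃o Set.Iic d where
  toFun x := ⟨γ x.1, (γ.monotone x.2).trans_eq hd⟩
  invFun x := ⟨γ.symm x.1, (γ.symm.monotone x.2).trans_eq (γ.symm_apply_eq.2 hd.symm)⟩
  left_inv x := Subtype.ext (γ.symm_apply_apply x.1)
  right_inv x := Subtype.ext (γ.apply_symm_apply x.1)
  map_rel_iff' := γ.le_iff_le

/-- Conjugacy, i.e. isomorphism of the dynamical systems `⟨A, α⟩` and `⟨B, β⟩`: there is an
isomorphism `φ` from `A` onto `B` with `φ ∘ α = β ∘ φ`. (For Boolean algebras, in particular for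
relative algebras `{x | x ≤ d}`, the order determines the whole structure.) -/
def AreConjugate {A B : Type*} [PartialOrder A] [PartialOrder B] (α : A ≃o A) (β : B ≃o B) :
    Prop :=
  ∃ φ : A ≃o B, ∀ x : A, φ (α x) = β (φ x)

/-- The continuum hypothesis. -/
def CH : Prop := Cardinal.continuum.{0} = Cardinal.aleph.{0} 1

/-- The assertion that all automorphisms of `P(ℕ)/Fin` are trivial. -/
def AllAutTrivial : Prop := ∀ γ : AutPFin ℕ, IsTrivialAut γ

end PModFin

/-! A rotation of consecutive blocks acts on `P(ℕ)/Fin` as the coordinatewise rotation of the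
reduced product, modulo finite sets, of the finite structures `P(ℤ/n k)` with inclusion and the
graph of the rotation. For each game length there are finitely many types of such structures, so
some lengths `u k` have converging types (`exists_strictMono_backForth`). Each `x` in the Cantor
space gives the automorphism with block lengths `u (branch x k)`; the ranges of the `branch x` are
almost disjoint.

A rotation is transitive on its block, so an invariant element contains or misses almost every block
entirely. Restricting to a nonzero invariant element therefore only passes to a subsequence of
blocks (`exists_conjugate_restrictAut`).

Under CH all these reduced products are isomorphic: the limit types agree, countable saturation
extends any countable partial map, and a construction of length `ω₁` exhausts both sides
(`blockAut_conjugate_of_CH`).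

If all automorphisms are trivial, a conjugacy comes from an almost bijection that commutes with the
rotations off a finite set. It carries almost every cycle onto a cycle of equal length
(`eventually_mem_range_of_induced`), which almost disjointness forbids for distinct `x`. -/

open Filter Set

namespace PModFin

/-! ### Ehrenfeucht–Fraïssé games -/

/-- The second player survives `r` more rounds of the Ehrenfeucht–Fraïssé game between the
structures `⟨M, ≤, σ⟩` and `⟨N, ≤, τ⟩` in which the pairs in `S` have been played. -/
def BackForth {M N : Type*} [LE M] [LE N] (σ : M → M) (τ : N → N) : ℕ → Set (M × N) → Prop
  | 0, S => ∀ p ∈ S, ∀ q ∈ S, (p.1 ≤ q.1 ↔ p.2 ≤ q.2) ∧ (σ p.1 = q.1 ↔ τ p.2 = q.2)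
  | r + 1, S => BackForth σ τ r S ∧ (∀ a, ∃ b, BackForth σ τ r (insert (a, b) S)) ∧
      ∀ b, ∃ a, BackForth σ τ r (insert (a, b) S)

namespace BackForth

variable {M N : Type*} [LE M] [LE N] {σ : M → M} {τ : N → N}

theorem subset : ∀ {r : ℕ} {S T : Set (M × N)}, BackForth σ τ r S → T ⊆ S → BackForth σ τ r T
  | 0, _, _, h, hT => fun p hp q hq => h p (hT hp) q (hT hq)
  | _ + 1, _, _, h, hT =>
    ⟨h.1.subset hT,
      fun a => (h.2.1 a).imp fun _ hb => hb.subset (insert_subset_insert hT),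
      fun b => (h.2.2 b).imp fun _ ha => ha.subset (insert_subset_insert hT)⟩

theorem mono {r s : ℕ} {S : Set (M × N)} (h : BackForth σ τ s S) (hrs : r ≤ s) :
    BackForth σ τ r S := by
  induction s, hrs using Nat.le_induction with
  | base => exact h
  | succ s _ ih => exact ih h.1

theorem swap : ∀ {r : ℕ} {S : Set (M × N)}, BackForth σ τ r S →
    BackForth τ σ r (Prod.swap ⁻¹' S)
  | 0, _, h => fun p hp q hq => ⟨(h _ hp _ hq).1.symm, (h _ hp _ hq).2.symm⟩
  | _ + 1, S, h => by
    have key : ∀ a b, Prod.swap ⁻¹' (insert (a, b) S) = insert (b, a) (Prod.swap ⁻¹' S) := by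
      rintro a b
      ext ⟨x, y⟩
      simp [and_comm]
    refine ⟨h.1.swap, fun b => (h.2.2 b).imp fun a ha => ?_, fun a => (h.2.1 a).imp fun b hb => ?_⟩
    · exact key a b ▸ ha.swap
    · exact key a b ▸ hb.swap

end BackForth

/-- The possible isomorphism types, with respect to games of length `r`, of `m`-tuples. -/
def GameType : ℕ → ℕ → Type
  | 0, m => Fin m → Fin m → Prop × Prop
  | r + 1, m => GameType r m × Set (GameType r (m + 1))

instance GameType.instFinite : ∀ r m, Finite (GameType r m)
  | 0, m => inferInstanceAs (Finite (Fin m → Fin m → Prop × Prop))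
  | r + 1, m => by
    have := GameType.instFinite r m
    have := GameType.instFinite r (m + 1)
    exact inferInstanceAs (Finite (GameType r m × Set (GameType r (m + 1))))

/-- The isomorphism type of a tuple with respect to games of length `r`. -/
def gameType {M : Type*} [LE M] (σ : M → M) : ∀ (r m : ℕ), (Fin m → M) → GameType r m
  | 0, _, a => fun i j => (a i ≤ a j, σ (a i) = a j)
  | r + 1, m, a => (gameType σ r m a, range fun x => gameType σ r (m + 1) (Fin.cons x a))

/-- A type records the types of all one-point extensions, so against a tuple of equal type every
move has an answer that keeps the types equal. -/
theorem backForth_of_gameType_eq {M N : Type*} [LE M] [LE N] {σ : M → M} {τ : N → N} :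
    ∀ {r m : ℕ} {a : Fin m → M} {b : Fin m → N}, gameType σ r m a = gameType τ r m b →
      BackForth σ τ r (range fun i => (a i, b i))
  | 0, _, _, _, h => by
    rintro _ ⟨i, rfl⟩ _ ⟨j, rfl⟩
    have h' := Prod.ext_iff.1 (congrFun (congrFun h i) j)
    exact ⟨iff_of_eq h'.1, iff_of_eq h'.2⟩
  | r + 1, m, a, b, h => by
    have h' := Prod.ext_iff.1 h
    have h2 : (range fun x => gameType σ r (m + 1) (Fin.cons x a)) =
      range fun x => gameType τ r (m + 1) (Fin.cons x b) := h'.2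
    have key : ∀ x y, gameType τ r (m + 1) (Fin.cons y b) = gameType σ r (m + 1) (Fin.cons x a) →
        BackForth σ τ r (insert (x, y) (range fun i => (a i, b i))) := by
      intro x y hxy
      refine (backForth_of_gameType_eq hxy.symm).subset ?_
      rintro _ (rfl | ⟨i, rfl⟩)
      · exact ⟨0, by simp⟩
      · exact ⟨i.succ, by simp⟩
    refine ⟨backForth_of_gameType_eq h'.1, fun x => ?_, fun y => ?_⟩
    · obtain ⟨y, hy⟩ := h2.subset ⟨x, rfl⟩
      exact ⟨y, key x y hy⟩
    · obtain ⟨x, hx⟩ := h2.superset ⟨y, rfl⟩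
      exact ⟨x, key x y hx.symm⟩

/-- Among the members of a sequence of structures there are, for every `r`, only finitely many up
to games of length `r`, so some subsequence converges. -/
theorem exists_strictMono_backForth {M : ℕ → Type*} [∀ n, LE (M n)] (σ : ∀ n, M n → M n) :
    ∃ u : ℕ → ℕ, StrictMono u ∧ (∀ k, 0 < u k) ∧
      ∀ r i j, r ≤ i → r ≤ j → BackForth (σ (u i)) (σ (u j)) r ∅ := by
  -- The ultrafilter picks one type for each game length; finitely many of these choices hold
  -- together on an infinite set, which permits a diagonal subsequence.
  let U : Ultrafilter ℕ := hyperfilter ℕ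
  have hU : (U : Filter ℕ) ≤ atTop := by
    rw [← Nat.cofinite_eq_atTop]
    exact hyperfilter_le_cofinite
  have h1 : ∀ r, ∃ t : GameType r 0, ∀ᶠ n in (U : Filter ℕ), gameType (σ n) r 0 Fin.elim0 = t :=
    fun r => Ultrafilter.eventually_exists_iff.1 (Eventually.of_forall fun n => ⟨_, rfl⟩)
  choose t ht using h1
  have h2 : ∀ r, ∃ᶠ n in atTop, 0 < n ∧ ∀ s ≤ r, gameType (σ n) s 0 Fin.elim0 = t s := by
    intro r
    refine Frequently.filter_mono (Eventually.frequently ?_) hU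
    exact Filter.Eventually.and (hU (eventually_gt_atTop 0))
      ((eventually_all_finite (finite_Iic r)).2 fun s _ => ht s)
  obtain ⟨u, hu, hut⟩ := extraction_forall_of_frequently h2
  refine ⟨u, hu, fun k => (hut k).1, fun r i j hi hj => ?_⟩
  exact (backForth_of_gameType_eq (((hut i).2 r hi).trans ((hut j).2 r hj).symm)).subset
    (empty_subset _)

/-! ### Back-and-forth constructions of length `ω₁` -/

/-- The requests in `A ⊕ B` are met along a well-order with countable initial segments, so each
stage extends a countable good set. Finite character of `Good` handles limit stages and the final
union. -/
theorem exists_total_of_backAndForth {A B : Type} (hA : Cardinal.mk A ≤ Cardinal.aleph 1)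
    (hB : Cardinal.mk B ≤ Cardinal.aleph 1) (Good : Set (A × B) → Prop)
    (hfin : ∀ S, (∀ F ⊆ S, F.Finite → Good F) → Good S)
    (hmono : ∀ S T, T ⊆ S → Good S → Good T) (hempty : Good ∅)
    (forth : ∀ S, S.Countable → Good S → ∀ a, ∃ b, Good (insert (a, b) S))
    (back : ∀ S, S.Countable → Good S → ∀ b, ∃ a, Good (insert (a, b) S)) :
    ∃ S, Good S ∧ (∀ a, ∃ b, (a, b) ∈ S) ∧ ∀ b, ∃ a, (a, b) ∈ S := by
  have hI : Cardinal.mk (A ⊕ B) ≤ Cardinal.aleph 1 := by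
    rw [Cardinal.mk_sum, Cardinal.lift_id, Cardinal.lift_id]
    exact Cardinal.add_le_of_le (Cardinal.aleph0_le_aleph 1) hA hB
  obtain ⟨_, _, hord⟩ := Cardinal.exists_ord_eq_type_lt (A ⊕ B)
  have hcount : ∀ x : A ⊕ B, (Iio x).Countable := by
    intro x
    rw [← Cardinal.le_aleph0_iff_set_countable]
    have h1 := (Cardinal.mk_Iio_lt x hord).trans_le hI
    rwa [← Order.lt_succ_iff, Cardinal.succ_aleph0]
  -- Made total in `S` so that it can drive a recursion; an answer over `∅` serves when `S` is not
  -- countable and good.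
  have hstep : ∀ (S : Set (A × B)) (x : A ⊕ B), ∃ p : A × B,
      (S.Countable → Good S → Good (insert p S)) ∧
        Sum.elim (fun a => p.1 = a) (fun b => p.2 = b) x := by
    intro S x
    by_cases hS : S.Countable ∧ Good S
    · rcases x with a | b
      · obtain ⟨b, hb⟩ := forth S hS.1 hS.2 a
        exact ⟨(a, b), fun _ _ => hb, rfl⟩
      · obtain ⟨a, ha⟩ := back S hS.1 hS.2 b
        exact ⟨(a, b), fun _ _ => ha, rfl⟩
    · rcases x with a | b
      · obtain ⟨b, hb⟩ := forth ∅ countable_empty hempty a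
        exact ⟨(a, b), fun h h' => absurd ⟨h, h'⟩ hS, rfl⟩
      · obtain ⟨a, ha⟩ := back ∅ countable_empty hempty b
        exact ⟨(a, b), fun h h' => absurd ⟨h, h'⟩ hS, rfl⟩
  choose step hstep1 hstep2 using hstep
  let f : A ⊕ B → A × B := (wellFounded_lt (α := A ⊕ B)).fix fun x ih =>
    step (range fun y : Iio x => ih y.1 y.2) x
  have hf : ∀ x, f x = step (f '' Iio x) x := by
    intro x
    rw [image_eq_range]
    exact WellFounded.fix_eq _ _ x
  -- A finite subset of the image comes from finitely many indices, hence lies in the stage of the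
  -- largest one.
  have hdir : ∀ s : Set (A ⊕ B), (∀ x ∈ s, Good (f '' Iic x)) → Good (f '' s) := by
    intro s hs
    refine hfin _ fun F hF hFfin => ?_
    obtain ⟨T, hTs, hTfin, rfl⟩ :=
      exists_subset_image_finite_and.1 (⟨F, hF, hFfin, rfl⟩ : ∃ G ⊆ f '' s, G.Finite ∧ G = F)
    rcases T.eq_empty_or_nonempty with rfl | hT
    · simpa using hempty
    · obtain ⟨x, hxT, hx⟩ := exists_max_image T id hTfin hT
      exact hmono _ _ (image_mono fun y hy => hx y hy) (hs x (hTs hxT))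
  have hgood : ∀ x, Good (f '' Iic x) := by
    intro x
    induction x using WellFoundedLT.induction with
    | ind x ih =>
      rw [← Iio_insert, image_insert_eq, hf x]
      exact hstep1 _ x ((hcount x).image f) (hdir _ fun y hy => ih y hy)
  refine ⟨range f, ?_, fun a => ⟨(f (Sum.inl a)).2, Sum.inl a, ?_⟩,
    fun b => ⟨(f (Sum.inr b)).1, Sum.inr b, ?_⟩⟩
  · rw [← image_univ]
    exact hdir _ fun x _ => hgood x
  · have h := hstep2 (f '' Iio (Sum.inl a)) (Sum.inl a)
    rw [← hf] at h
    exact Prod.ext h rfl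
  · have h := hstep2 (f '' Iio (Sum.inr b)) (Sum.inr b)
    rw [← hf] at h
    exact Prod.ext rfl h

end PModFin

namespace PModFin

/-! ### Saturation of reduced products modulo finite sets -/

section Sections

variable {M N : ℕ → Type} [∀ k, LE (M k)] [∀ k, LE (N k)]
  {σ : ∀ k, M k → M k} {τ : ∀ k, N k → N k}

/-- The pairs in `S` define a partial elementary map between the reduced products of the `M k` and
of the `N k` modulo the finite sets. -/
def IsReducedBackForth (σ : ∀ k, M k → M k) (τ : ∀ k, N k → N k)
    (S : Set ((∀ k, M k) × (∀ k, N k))) : Prop :=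
  ∀ F ⊆ S, F.Finite → ∀ r, ∀ᶠ k in atTop,
    BackForth (σ k) (τ k) r ((fun p => (p.1 k, p.2 k)) '' F)

theorem IsReducedBackForth.swap {S : Set ((∀ k, M k) × (∀ k, N k))}
    (h : IsReducedBackForth σ τ S) : IsReducedBackForth τ σ (Prod.swap ⁻¹' S) := by
  intro F hF hFfin r
  have hsub : Prod.swap '' F ⊆ S := by
    rintro _ ⟨p, hp, rfl⟩
    exact hF hp
  filter_upwards [h _ hsub (hFfin.image _) r] with k hk
  refine hk.swap.subset ?_
  rintro _ ⟨p, hp, rfl⟩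
  exact ⟨p.swap, ⟨p, hp, rfl⟩, rfl⟩

theorem exists_finite_exhaustion {α : Type*} {S : Set α} (hS : S.Countable) :
    ∃ F : ℕ → Set α, Monotone F ∧ (∀ i, F i ⊆ S ∧ (F i).Finite) ∧
      ∀ T ⊆ S, T.Finite → ∃ i, T ⊆ F i := by
  obtain ⟨f, hf⟩ := countable_iff_exists_injOn.1 hS
  refine ⟨fun i => S ∩ f ⁻¹' Iio i, fun i j hij => ?_, fun i => ⟨inter_subset_left, ?_⟩,
    fun T hT hTfin => ?_⟩
  · exact inter_subset_inter_right _ (preimage_mono (Iio_subset_Iio hij))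
  · refine Finite.of_finite_image ((finite_Iio i).subset ?_) (hf.mono inter_subset_left)
    rintro _ ⟨x, hx, rfl⟩
    exact hx.2
  · obtain ⟨i, hi⟩ := (hTfin.image f).bddAbove
    exact ⟨i + 1, fun x hx => ⟨hT hx, Nat.lt_succ_of_le (hi ⟨x, hx, rfl⟩)⟩⟩

/-- The reduced products of the `M k` and of the `N k` modulo the finite sets are countably
saturated over each other. -/
theorem IsReducedBackForth.exists_forth [∀ k, Nonempty (N k)] {S : Set ((∀ k, M k) × (∀ k, N k))}
    (hS : S.Countable) (h : IsReducedBackForth σ τ S) (a : ∀ k, M k) :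
    ∃ b, IsReducedBackForth σ τ (insert (a, b) S) := by
  classical
  obtain ⟨F, hFmono, hFS, hFex⟩ := exists_finite_exhaustion hS
  let ev : ∀ k, (∀ k, M k) × (∀ k, N k) → M k × N k := fun k p => (p.1 k, p.2 k)
  -- Diagonalization: coordinate `k` uses the largest `i ≤ k` for which `F i` survives `i + 1`
  -- rounds, and spends one of them to answer `a k`. This `i` tends to infinity with `k`.
  let P : ℕ → ℕ → Prop := fun k i => BackForth (σ k) (τ k) (i + 1) (ev k '' F i)
  have hP : ∀ i, ∀ᶠ k in atTop, P k i := fun i => h _ (hFS i).1 (hFS i).2 _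
  let r : ℕ → ℕ := fun k => Nat.findGreatest (P k) k
  have hb : ∀ k, ∃ y : N k, P k (r k) →
      BackForth (σ k) (τ k) (r k) (insert (a k, y) (ev k '' F (r k))) := by
    intro k
    by_cases hk : P k (r k)
    · obtain ⟨y, hy⟩ := hk.2.1 (a k)
      exact ⟨y, fun _ => hy⟩
    · exact ⟨Classical.arbitrary _, fun h => absurd h hk⟩
  choose b hb using hb
  refine ⟨b, fun T hT hTfin s => ?_⟩
  obtain ⟨j, hj⟩ := hFex (T ∩ S) inter_subset_right (hTfin.subset inter_subset_left)
  filter_upwards [hP (max s j), eventually_ge_atTop (max s j)] with k hk hk'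
  have h1 : max s j ≤ r k := Nat.le_findGreatest hk' hk
  have h2 : P k (r k) := Nat.findGreatest_spec hk' hk
  refine ((hb k h2).mono ((le_max_left s j).trans h1)).subset ?_
  rintro _ ⟨p, hp, rfl⟩
  rcases hT hp with rfl | hpS
  · exact Or.inl rfl
  · exact Or.inr ⟨p, hFmono ((le_max_right s j).trans h1) (hj ⟨hp, hpS⟩), rfl⟩

theorem mk_pi_le_continuum (M : ℕ → Type) [∀ k, Countable (M k)] :
    Cardinal.mk (∀ k, M k) ≤ Cardinal.continuum := by
  have h : ∀ k, ∃ f : M k → ℕ, Function.Injective f := fun k => exists_injective_nat _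
  choose f hf using h
  have h2 : Cardinal.mk (ℕ → ℕ) = Cardinal.continuum := by simp
  rw [← h2]
  exact Cardinal.mk_le_of_injective (f := fun x k => f k (x k))
    fun x y hxy => funext fun k => hf k (congrFun hxy k)

/-- CH bounds both products by `ℵ₁`. The conclusion needs only games of length 0 on pairs; the
longer games keep the construction going. -/
theorem exists_total_of_CH (hCH : CH) [∀ k, Countable (M k)] [∀ k, Countable (N k)]
    [∀ k, Nonempty (M k)] [∀ k, Nonempty (N k)]
    (h : ∀ r, ∀ᶠ k in atTop, BackForth (σ k) (τ k) r ∅) :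
    ∃ S : Set ((∀ k, M k) × (∀ k, N k)),
      (∀ a, ∃ b, (a, b) ∈ S) ∧ (∀ b, ∃ a, (a, b) ∈ S) ∧
      ∀ p ∈ S, ∀ q ∈ S,
        ((∀ᶠ k in atTop, p.1 k ≤ q.1 k) ↔ ∀ᶠ k in atTop, p.2 k ≤ q.2 k) ∧
        ((∀ᶠ k in atTop, σ k (p.1 k) = q.1 k) ↔ ∀ᶠ k in atTop, τ k (p.2 k) = q.2 k) := by
  obtain ⟨S, hS, h1, h2⟩ := exists_total_of_backAndForth
    ((mk_pi_le_continuum M).trans_eq hCH) ((mk_pi_le_continuum N).trans_eq hCH)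
    (IsReducedBackForth σ τ) (fun S hS F hF hFfin => hS F hF hFfin F subset_rfl hFfin)
    (fun S T hTS hS F hF => hS F (hF.trans hTS))
    (fun F hF _ r => by simpa [subset_empty_iff.1 hF] using h r)
    (fun S hS hg a => hg.exists_forth hS a)
    (fun S hS hg b => by
      obtain ⟨a, ha⟩ := hg.swap.exists_forth (hS.preimage Prod.swap_injective) b
      refine ⟨a, fun F hF => ha.swap F (hF.trans ?_)⟩
      rintro p (rfl | hp)
      · exact Or.inl rfl
      · exact Or.inr hp)
  refine ⟨S, h1, h2, fun p hp q hq => ?_⟩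
  have hpq := hS {p, q} (by simp [insert_subset_iff, hp, hq]) (toFinite _) 0
  have hmem : ∀ k, (p.1 k, p.2 k) ∈ (fun p : (∀ k, M k) × (∀ k, N k) => (p.1 k, p.2 k)) '' {p, q} ∧
      (q.1 k, q.2 k) ∈ (fun p : (∀ k, M k) × (∀ k, N k) => (p.1 k, p.2 k)) '' {p, q} :=
    fun k => ⟨⟨p, by simp, rfl⟩, ⟨q, by simp, rfl⟩⟩
  exact ⟨eventually_congr (hpq.mono fun k hk => (hk _ (hmem k).1 _ (hmem k).2).1),
    eventually_congr (hpq.mono fun k hk => (hk _ (hmem k).1 _ (hmem k).2).2)⟩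

end Sections

/-! ### Maps induced by injections -/

variable {X Y : Type*}

/-- The embedding of `P(X)/Fin` into `P(Y)/Fin` induced by an injection of `X` into `Y`. -/
def imageEmbedding (f : X → Y) (hf : Function.Injective f) : PFin X ↪o PFin Y :=
  OrderEmbedding.ofMapLEIff
    (Quotient.map (image f) fun A B h => by
      change (f '' A \ f '' B).Finite ∧ (f '' B \ f '' A).Finite
      rw [← image_sdiff hf, ← image_sdiff hf]
      exact ⟨h.1.image f, h.2.image f⟩)
    fun a b => by
      obtain ⟨A, rfl⟩ := cls_surj a
      obtain ⟨B, rfl⟩ := cls_surj b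
      change (f '' A \ f '' B).Finite ↔ (A \ B).Finite
      rw [← image_sdiff hf, finite_image_iff hf.injOn]

theorem imageEmbedding_cls (f : X → Y) (hf : Function.Injective f) (A : Set X) :
    imageEmbedding f hf (cls A) = cls (f '' A) := rfl

/-- The isomorphism of `P(X)/Fin` onto `P(Y)/Fin` induced by a bijection of `X` onto `Y`. -/
noncomputable def imageIso (f : X ≃ Y) : PFin X ≃o PFin Y :=
  RelIso.ofSurjective (imageEmbedding f f.injective) fun b => by
    obtain ⟨B, rfl⟩ := cls_surj b
    exact ⟨cls (f ⁻¹' B), by rw [imageEmbedding_cls, f.image_preimage]⟩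

theorem imageIso_cls (f : X ≃ Y) (A : Set X) : imageIso f (cls A) = cls (f '' A) := rfl

theorem imageIso_symm_cls (f : X ≃ Y) (B : Set Y) :
    (imageIso f).symm (cls B) = cls (f ⁻¹' B) := by
  rw [OrderIso.symm_apply_eq, imageIso_cls, f.image_preimage]

/-- An injection of `X` into `Y` induces an isomorphism of `P(X)/Fin` onto the relative algebra
below the class of its range. -/
noncomputable def imageIsoIic (f : X → Y) (hf : Function.Injective f) (d : PFin Y)
    (hd : cls (range f) = d) : PFin X ≃o Iic d :=
  RelIso.ofSurjective
    (OrderEmbedding.ofMapLEIff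
      (fun a => (⟨imageEmbedding f hf a, by
        obtain ⟨A, rfl⟩ := cls_surj a
        rw [mem_Iic, imageEmbedding_cls, ← hd, cls_le_cls,
          sdiff_eq_empty.2 (image_subset_range f A)]
        exact finite_empty⟩ : Iic d))
      fun a b => (imageEmbedding f hf).le_iff_le)
    fun ⟨b, hb⟩ => by
      obtain ⟨B, rfl⟩ := cls_surj b
      rw [mem_Iic, ← hd, cls_le_cls] at hb
      refine ⟨cls (f ⁻¹' B), Subtype.ext ?_⟩
      change cls (f '' (f ⁻¹' B)) = cls B
      rw [cls_eq_cls, image_preimage_eq_inter_range, sdiff_self_inter]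
      exact ⟨by simp [sdiff_eq_empty.2 inter_subset_left], hb⟩

/-! ### Conjugacy -/

theorem AreConjugate.symm {A B : Type*} [PartialOrder A] [PartialOrder B] {α : A ≃o A}
    {β : B ≃o B} (h : AreConjugate α β) : AreConjugate β α := by
  obtain ⟨φ, hφ⟩ := h
  refine ⟨φ.symm, fun x => ?_⟩
  rw [φ.symm_apply_eq, hφ, φ.apply_symm_apply]

theorem AreConjugate.trans {A B C : Type*} [PartialOrder A] [PartialOrder B] [PartialOrder C]
    {α : A ≃o A} {β : B ≃o B} {γ : C ≃o C} (h : AreConjugate α β) (h' : AreConjugate β γ) :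
    AreConjugate α γ := by
  obtain ⟨φ, hφ⟩ := h
  obtain ⟨ψ, hψ⟩ := h'
  exact ⟨φ.trans ψ, fun x => by simp [hφ, hψ]⟩

/-- Antisymmetry makes such a relation single-valued. This lets a relation between representatives
descend to the quotients. -/
theorem exists_orderIso_of_rel {P Q : Type*} [PartialOrder P] [PartialOrder Q] (R : P → Q → Prop)
    (hP : ∀ p, ∃ q, R p q) (hQ : ∀ q, ∃ p, R p q)
    (hR : ∀ p q p' q', R p q → R p' q' → (p ≤ p' ↔ q ≤ q')) :
    ∃ φ : P ≃o Q, ∀ p q, R p q → φ p = q := by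
  choose f hf using hP
  have huniq : ∀ p q, R p q → f p = q := fun p q h =>
    le_antisymm ((hR _ _ _ _ (hf p) h).1 le_rfl) ((hR _ _ _ _ h (hf p)).1 le_rfl)
  refine ⟨RelIso.ofSurjective
    (OrderEmbedding.ofMapLEIff f fun p p' => (hR _ _ _ _ (hf p) (hf p')).symm) fun q => ?_, huniq⟩
  obtain ⟨p, hp⟩ := hQ q
  exact ⟨p, huniq p q hp⟩

/-! ### Rotations of blocks -/

/-- The permutation of a disjoint union of cycles of lengths `n k` that rotates every cycle. -/
def blockShift (n : ℕ → ℕ) : Equiv.Perm (Σ k, ZMod (n k)) :=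
  Equiv.sigmaCongrRight fun k => Equiv.addRight (1 : ZMod (n k))

theorem blockShift_mk (n : ℕ → ℕ) (k : ℕ) (j : ZMod (n k)) :
    blockShift n ⟨k, j⟩ = ⟨k, j + 1⟩ := rfl

/-- The automorphism induced by `blockShift n`. -/
noncomputable def blockAut (n : ℕ → ℕ) : AutPFin (Σ k, ZMod (n k)) := imageIso (blockShift n)

theorem blockAut_cls (n : ℕ → ℕ) (A : Set (Σ k, ZMod (n k))) :
    blockAut n (cls A) = cls (blockShift n '' A) := rfl

/-- The rotation of the subsets of a cycle of length `N`. -/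
def rotate (N : ℕ) : Set (ZMod N) → Set (ZMod N) := image (· + 1)

/-- The part of a subset of a disjoint union that lies in the `k`-th summand. -/
def fiber {β : ℕ → Type*} (A : Set (Σ k, β k)) (k : ℕ) : Set (β k) := {j | ⟨k, j⟩ ∈ A}

theorem fiber_blockShift_image (n : ℕ → ℕ) (A : Set (Σ k, ZMod (n k))) (k : ℕ) :
    fiber (blockShift n '' A) k = rotate (n k) (fiber A k) := by
  ext j
  constructor
  · rintro ⟨⟨k', j'⟩, hA, h⟩
    rw [blockShift_mk] at h
    obtain ⟨rfl, h⟩ := Sigma.mk.inj_iff.1 h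
    exact ⟨j', hA, eq_of_heq h⟩
  · rintro ⟨j', hA, rfl⟩
    exact ⟨⟨k, j'⟩, hA, rfl⟩

/-- As the summands are finite, a set is finite iff it meets finitely many of them; this identifies
`P/Fin` of the union with the reduced product. -/
theorem cls_le_cls_iff_eventually {β : ℕ → Type*} [∀ k, Finite (β k)] {A B : Set (Σ k, β k)} :
    cls A ≤ cls B ↔ ∀ᶠ k in atTop, fiber A k ≤ fiber B k := by
  rw [cls_le_cls, ← Nat.cofinite_eq_atTop, eventually_cofinite]
  constructor
  · refine fun h => (h.image Sigma.fst).subset fun k hk => ?_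
    obtain ⟨j, hj, hj'⟩ := not_subset.1 hk
    exact ⟨⟨k, j⟩, ⟨hj, hj'⟩, rfl⟩
  · refine fun h => (h.biUnion fun k _ => finite_range (Sigma.mk k)).subset ?_
    rintro ⟨k, j⟩ ⟨hA, hB⟩
    exact mem_biUnion (x := k) (fun h => hB (h hA)) ⟨j, rfl⟩

theorem cls_eq_cls_iff_eventually {β : ℕ → Type*} [∀ k, Finite (β k)] {A B : Set (Σ k, β k)} :
    cls A = cls B ↔ ∀ᶠ k in atTop, fiber A k = fiber B k := by
  rw [le_antisymm_iff, cls_le_cls_iff_eventually, cls_le_cls_iff_eventually, ← eventually_and]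
  exact eventually_congr (Eventually.of_forall fun k => le_antisymm_iff.symm)

theorem blockAut_conjugate_of_CH (hCH : CH) {m n : ℕ → ℕ} (hm : ∀ k, 0 < m k) (hn : ∀ k, 0 < n k)
    (h : ∀ r, ∀ᶠ k in atTop, BackForth (rotate (m k)) (rotate (n k)) r ∅) :
    AreConjugate (blockAut m) (blockAut n) := by
  have : ∀ k, NeZero (m k) := fun k => ⟨(hm k).ne'⟩
  have : ∀ k, NeZero (n k) := fun k => ⟨(hn k).ne'⟩
  obtain ⟨S, h1, h2, h3⟩ := exists_total_of_CH hCH (M := fun k => Set (ZMod (m k)))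
    (N := fun k => Set (ZMod (n k))) h
  let R : PFin (Σ k, ZMod (m k)) → PFin (Σ k, ZMod (n k)) → Prop := fun a b =>
    ∃ A B, (fiber A, fiber B) ∈ S ∧ cls A = a ∧ cls B = b
  obtain ⟨φ, hφ⟩ := exists_orderIso_of_rel R
    (fun a => by
      obtain ⟨A, rfl⟩ := cls_surj a
      obtain ⟨b, hb⟩ := h1 (fiber A)
      exact ⟨_, A, {p | p.2 ∈ b p.1}, hb, rfl, rfl⟩)
    (fun b => by
      obtain ⟨B, rfl⟩ := cls_surj b
      obtain ⟨a, ha⟩ := h2 (fiber B)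
      exact ⟨_, {p | p.2 ∈ a p.1}, B, ha, rfl, rfl⟩)
    (by
      rintro _ _ _ _ ⟨A, B, hAB, rfl, rfl⟩ ⟨A', B', hAB', rfl, rfl⟩
      rw [cls_le_cls_iff_eventually, cls_le_cls_iff_eventually]
      exact (h3 _ hAB _ hAB').1)
  have hset : ∀ A, ∃ B, (fiber A, fiber B) ∈ S := fun A => by
    obtain ⟨b, hb⟩ := h1 (fiber A)
    exact ⟨{p | p.2 ∈ b p.1}, hb⟩
  refine ⟨φ, fun a => ?_⟩
  obtain ⟨A, rfl⟩ := cls_surj a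
  obtain ⟨B, hB⟩ := hset A
  obtain ⟨B', hB'⟩ := hset (blockShift m '' A)
  rw [hφ _ _ ⟨A, B, hB, rfl, rfl⟩, blockAut_cls, hφ _ _ ⟨_, B', hB', rfl, rfl⟩, blockAut_cls,
    eq_comm, cls_eq_cls_iff_eventually]
  simp only [fiber_blockShift_image]
  exact (h3 _ hB _ hB').2.1 (Eventually.of_forall fun k => (fiber_blockShift_image m A k).symm)

end PModFin

namespace PModFin

/-! ### Rotary automorphisms -/

/-- The enumeration of a disjoint union of blocks by consecutive intervals of `ℕ`. -/
def blockIndex (n : ℕ → ℕ) (p : Σ k, ZMod (n k)) : ℕ := blockStart n p.1 + p.2.val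

theorem blockStart_succ (n : ℕ → ℕ) (k : ℕ) : blockStart n (k + 1) = blockStart n k + n k :=
  Finset.sum_range_succ _ _

theorem blockIndex_natCast {n : ℕ → ℕ} {k j : ℕ} (hj : j < n k) :
    blockIndex n ⟨k, j⟩ = blockStart n k + j := by
  rw [blockIndex, ZMod.val_cast_of_lt hj]

theorem blockIndex_bijective {n : ℕ → ℕ} (hn : ∀ k, 0 < n k) :
    Function.Bijective (blockIndex n) := by
  have : ∀ k, NeZero (n k) := fun k => ⟨(hn k).ne'⟩
  have hmono : Monotone (blockStart n) := monotone_nat_of_le_succ fun k => by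
    rw [blockStart_succ]
    exact Nat.le_add_right _ _
  have hlt : ∀ p q : Σ k, ZMod (n k), p.1 < q.1 → blockIndex n p < blockIndex n q := by
    intro p q hpq
    have h1 := hmono (Nat.succ_le_of_lt hpq)
    rw [Nat.succ_eq_add_one, blockStart_succ] at h1
    have h2 := ZMod.val_lt p.2
    unfold blockIndex
    omega
  constructor
  · rintro ⟨k, i⟩ ⟨l, j⟩ h
    obtain rfl : k = l := by
      rcases lt_trichotomy k l with hkl | hkl | hkl
      · exact absurd h (hlt _ _ hkl).ne
      · exact hkl
      · exact absurd h (hlt _ _ hkl).ne'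
    exact congrArg (Sigma.mk k) (ZMod.val_injective _ (Nat.add_left_cancel h))
  · intro N
    induction N with
    | zero => exact ⟨⟨0, (0 : ℕ)⟩, by rw [blockIndex_natCast (hn 0)]; simp [blockStart]⟩
    | succ N ih =>
      obtain ⟨⟨k, j⟩, hj⟩ := ih
      have hval := ZMod.val_lt j
      rw [blockIndex] at hj
      dsimp only at hj
      rcases Nat.lt_or_ge (j.val + 1) (n k) with h | h
      · exact ⟨⟨k, (j.val + 1 : ℕ)⟩, by rw [blockIndex_natCast h]; omega⟩
      · exact ⟨⟨k + 1, (0 : ℕ)⟩, by rw [blockIndex_natCast (hn _), blockStart_succ]; omega⟩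

/-- `blockIndex n` as a bijection. -/
noncomputable def blockEquiv {n : ℕ → ℕ} (hn : ∀ k, 0 < n k) : (Σ k, ZMod (n k)) ≃ ℕ :=
  Equiv.ofBijective (blockIndex n) (blockIndex_bijective hn)

/-- The rotary permutation of `ℕ` with block lengths `n k`. -/
noncomputable def rotaryPerm {n : ℕ → ℕ} (hn : ∀ k, 0 < n k) : Equiv.Perm ℕ :=
  (blockEquiv hn).symm.trans ((blockShift n).trans (blockEquiv hn))

theorem rotaryPerm_blockEquiv {n : ℕ → ℕ} (hn : ∀ k, 0 < n k) (p : Σ k, ZMod (n k)) :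
    rotaryPerm hn (blockEquiv hn p) = blockEquiv hn (blockShift n p) := by
  simp [rotaryPerm]

theorem isRotaryPermOf_rotaryPerm {n : ℕ → ℕ} (hn : ∀ k, 0 < n k) :
    IsRotaryPermOf n (rotaryPerm hn) := by
  intro k j hj
  have h1 : blockEquiv hn ⟨k, j⟩ = blockStart n k + j := blockIndex_natCast hj
  rw [← h1, rotaryPerm_blockEquiv, blockShift_mk]
  change blockStart n k + ((j : ZMod (n k)) + 1).val = _
  rw [← Nat.cast_add_one, ZMod.val_natCast]

/-- The automorphism of `P(ℕ)/Fin` induced by the rotary permutation with block lengths `n k`. -/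
noncomputable def rotaryAut {n : ℕ → ℕ} (hn : ∀ k, 0 < n k) : AutPFin ℕ := imageIso (rotaryPerm hn)

theorem isInducedBy_rotaryAut {n : ℕ → ℕ} (hn : ∀ k, 0 < n k) :
    IsInducedBy (rotaryAut hn) (rotaryPerm hn).toPartialEquiv := by
  intro A
  simp [rotaryAut, imageIso_cls]

theorem isRotaryAut_rotaryAut {n : ℕ → ℕ} (hn : ∀ k, 0 < n k) : IsRotaryAut (rotaryAut hn) :=
  ⟨n, rotaryPerm hn, hn, isRotaryPermOf_rotaryPerm hn, isInducedBy_rotaryAut hn⟩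

theorem isTrivialAut_rotaryAut {n : ℕ → ℕ} (hn : ∀ k, 0 < n k) : IsTrivialAut (rotaryAut hn) :=
  ⟨_, by simp [IsAlmostPerm], isInducedBy_rotaryAut hn⟩

theorem rotaryPerm_image {Z : Type*} {n : ℕ → ℕ} (hn : ∀ k, 0 < n k) (f : Z → Σ k, ZMod (n k))
    (A : Set Z) :
    rotaryPerm hn '' ((fun z => blockEquiv hn (f z)) '' A) =
      (fun z => blockEquiv hn (blockShift n (f z))) '' A := by
  rw [image_image]
  simp only [rotaryPerm_blockEquiv]

theorem imageIso_blockEquiv_blockAut {n : ℕ → ℕ} (hn : ∀ k, 0 < n k)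
    (a : PFin (Σ k, ZMod (n k))) :
    imageIso (blockEquiv hn) (blockAut n a) = rotaryAut hn (imageIso (blockEquiv hn) a) := by
  obtain ⟨A, rfl⟩ := cls_surj a
  rw [blockAut_cls, imageIso_cls, imageIso_cls, rotaryAut, imageIso_cls, image_image,
    image_image]
  simp only [rotaryPerm_blockEquiv]

/-- Adding 1 repeatedly leads from any point of the cycle to any other. -/
theorem eq_empty_or_univ_of_rotate_eq {N : ℕ} [NeZero N] {A : Set (ZMod N)} (h : rotate N A = A) :
    A = ∅ ∨ A = univ := by
  refine A.eq_empty_or_nonempty.imp_right fun ⟨x, hx⟩ => eq_univ_of_forall fun y => ?_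
  have key : ∀ i : ℕ, x + i ∈ A := by
    intro i
    induction i with
    | zero => simpa using hx
    | succ i ih =>
      rw [← h]
      exact ⟨_, ih, by push_cast; ring⟩
  simpa using key (y - x).val

/-- The restriction of a rotary automorphism to a nonzero invariant element is conjugate to the
rotation of the blocks of a subsequence. -/
theorem exists_conjugate_restrictAut {n : ℕ → ℕ} (hn : ∀ k, 0 < n k) (d : PFin ℕ)
    (hd : rotaryAut hn d = d) (hd0 : d ≠ ⊥) :
    ∃ e : ℕ → ℕ, StrictMono e ∧
      AreConjugate (blockAut (n ∘ e)) (restrictAut (rotaryAut hn) d hd) := by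
  have : ∀ k, NeZero (n k) := fun k => ⟨(hn k).ne'⟩
  obtain ⟨a, ha⟩ := (imageIso (blockEquiv hn)).surjective d
  obtain ⟨D, rfl⟩ := cls_surj a
  have hinv : blockAut n (cls D) = cls D := by
    apply (imageIso (blockEquiv hn)).injective
    rw [imageIso_blockEquiv_blockAut, ha, hd]
  rw [blockAut_cls, cls_eq_cls_iff_eventually] at hinv
  have hfib : ∀ᶠ k in atTop, fiber D k = ∅ ∨ fiber D k = univ := by
    filter_upwards [hinv] with k hk
    rw [fiber_blockShift_image] at hk
    exact eq_empty_or_univ_of_rotate_eq hk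
  -- The blocks inside `d`: infinitely many since `d ≠ ⊥`, and `e` enumerates them.
  let K : Set ℕ := {k | fiber D k = univ}
  have hK : K.Infinite := by
    intro hK
    apply hd0
    have h1 : ∀ᶠ k in atTop, k ∉ K := by
      rw [← Nat.cofinite_eq_atTop]
      exact hK.eventually_cofinite_notMem
    have h2 : cls D = cls ∅ := by
      rw [cls_eq_cls_iff_eventually]
      filter_upwards [h1, hfib] with k hk hk'
      exact hk'.resolve_right hk
    rw [← ha, h2, imageIso_cls, image_empty]
    rfl
  let e : ℕ → ℕ := Nat.nth (· ∈ K)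
  have he : StrictMono e := Nat.nth_strictMono hK
  have heK : range e = K := Nat.range_nth_of_infinite hK
  let f : (Σ k, ZMod (n (e k))) → Σ k, ZMod (n k) := fun p => ⟨e p.1, p.2⟩
  have hf : Function.Injective f := by
    rintro ⟨k, i⟩ ⟨l, j⟩ h
    obtain ⟨h1, h2⟩ := Sigma.mk.inj_iff.1 h
    obtain rfl := he.injective h1
    exact congrArg (Sigma.mk k) (eq_of_heq h2)
  have hrange : cls (range fun p => blockEquiv hn (f p)) = d := by
    rw [← ha, range_comp' (blockEquiv hn) f, ← imageIso_cls]
    congr 1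
    rw [cls_eq_cls_iff_eventually]
    filter_upwards [hfib] with k hk
    by_cases hkK : k ∈ K
    · rw [show fiber D k = univ from hkK, eq_univ_iff_forall]
      rw [← heK] at hkK
      obtain ⟨l, rfl⟩ := hkK
      exact fun j => ⟨⟨l, j⟩, rfl⟩
    · rw [hk.resolve_right hkK, eq_empty_iff_forall_notMem]
      rintro j ⟨p, hp⟩
      apply hkK
      rw [← heK]
      exact ⟨p.1, congrArg Sigma.fst hp⟩
  refine ⟨e, he, imageIsoIic _ ((blockEquiv hn).injective.comp hf) d hrange, fun a => ?_⟩
  obtain ⟨A, rfl⟩ := cls_surj a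
  apply Subtype.ext
  change cls ((fun p => blockEquiv hn (f p)) '' (blockShift (n ∘ e) '' A)) =
    cls (rotaryPerm hn '' ((fun p => blockEquiv hn (f p)) '' A))
  rw [rotaryPerm_image, image_image]
  rfl

/-! ### Trivial conjugacies -/

/-- Otherwise a sequence of points of disagreement can be chosen greedily whose `f`-values avoid all
its `g`-values; finite fibers leave room at each step. Its two images are then disjoint and
infinite, so their classes differ. -/
theorem finite_setOf_ne_of_cls_image_eq {X Y : Type*} {f g : X → Y}
    (hf : ∀ y, (f ⁻¹' {y}).Finite) (hg : ∀ y, (g ⁻¹' {y}).Finite)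
    (h : ∀ A, cls (f '' A) = cls (g '' A)) : {x | f x ≠ g x}.Finite := by
  by_contra hE
  obtain ⟨s, hs1, hs2⟩ := exists_seq_of_forall_finset_exists (fun x => f x ≠ g x)
    (fun x y => x ≠ y ∧ f x ≠ g y ∧ g x ≠ f y) (by
      intro F _
      have hfin : (↑F ∪ ((⋃ x ∈ F, g ⁻¹' {f x}) ∪ ⋃ x ∈ F, f ⁻¹' {g x}) : Set X).Finite :=
        F.finite_toSet.union ((F.finite_toSet.biUnion fun x _ => hg _).union
          (F.finite_toSet.biUnion fun x _ => hf _))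
      obtain ⟨y, hy, hy'⟩ := Set.Infinite.exists_notMem_finite hE hfin
      refine ⟨y, hy, fun x hx => ⟨?_, fun hxy => hy' ?_, fun hxy => hy' ?_⟩⟩
      · rintro rfl
        exact hy' (Or.inl hx)
      · exact Or.inr (Or.inl (mem_biUnion (x := x) hx hxy.symm))
      · exact Or.inr (Or.inr (mem_biUnion (x := x) hx hxy.symm)))
  have hsinj : Function.Injective s := by
    intro i j hij
    by_contra hne
    rcases lt_or_gt_of_ne hne with hlt | hlt
    · exact (hs2 _ _ hlt).1 hij
    · exact (hs2 _ _ hlt).1 hij.symm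
  have hdisj : ∀ i j, f (s i) ≠ g (s j) := by
    intro i j
    rcases lt_trichotomy i j with hij | rfl | hij
    · exact (hs2 _ _ hij).2.1
    · exact hs1 i
    · exact (hs2 _ _ hij).2.2.symm
  have h1 := (cls_eq_cls.1 (h (range s))).1
  have h2 : f '' range s \ g '' range s = f '' range s := by
    rw [sdiff_eq_left, Set.disjoint_left]
    rintro _ ⟨_, ⟨i, rfl⟩, rfl⟩ ⟨_, ⟨j, rfl⟩, hj⟩
    exact hdisj i j hj.symm
  rw [h2] at h1
  exact infinite_range_of_injective hsinj
    ((h1.preimage' fun y _ => hf y).subset (subset_preimage_image f _))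

/-- An isomorphism that is induced by an almost injective map and conjugates two rotations of
blocks maps almost every block onto a block of the same length. -/
theorem eventually_mem_range_of_induced {m n : ℕ → ℕ} (hm : ∀ k, 0 < m k)
    {φ : PFin (Σ k, ZMod (m k)) ≃o PFin (Σ k, ZMod (n k))}
    (hφ : ∀ a, φ (blockAut m a) = blockAut n (φ a))
    {h : (Σ k, ZMod (m k)) → Σ k, ZMod (n k)} {C : Set (Σ k, ZMod (m k))} (hC : Cᶜ.Finite)
    (hinj : InjOn h C) (hh : ∀ A, φ (cls A) = cls (h '' A)) :
    ∀ᶠ k in atTop, m k ∈ range n := by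
  have : ∀ k, NeZero (m k) := fun k => ⟨(hm k).ne'⟩
  have hfin : ∀ y, (h ⁻¹' {y}).Finite := by
    intro y
    refine (hC.union (Set.Subsingleton.finite (s := C ∩ h ⁻¹' {y}) ?_)).subset fun x hx => ?_
    · exact fun x hx x' hx' => hinj hx.1 hx'.1 (hx.2.trans hx'.2.symm)
    · by_cases hxC : x ∈ C
      · exact Or.inr ⟨hxC, hx⟩
      · exact Or.inl hxC
  have hE : {p | h (blockShift m p) ≠ blockShift n (h p)}.Finite := by
    refine finite_setOf_ne_of_cls_image_eq (f := fun p => h (blockShift m p))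
      (g := fun p => blockShift n (h p)) (fun y => ?_) (fun y => ?_) fun A => ?_
    · exact Finite.preimage (f := blockShift m) (s := h ⁻¹' {y}) (blockShift m).injective.injOn (hfin y)
    · refine (hfin ((blockShift n).symm y)).subset fun p hp => ?_
      exact (Equiv.eq_symm_apply _).2 hp
    · have := hφ (cls A)
      rwa [blockAut_cls, hh, hh, blockAut_cls, image_image, image_image] at this
  have hgood : ∀ᶠ k in atTop,
      k ∉ Sigma.fst '' ({p | h (blockShift m p) ≠ blockShift n (h p)} ∪ Cᶜ) := by
    rw [← Nat.cofinite_eq_atTop]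
    exact ((hE.union hC).image _).eventually_cofinite_notMem
  filter_upwards [hgood] with k hk
  have hk1 : ∀ j, h (blockShift m ⟨k, j⟩) = blockShift n (h ⟨k, j⟩) := fun j => by
    by_contra hne
    exact hk ⟨⟨k, j⟩, Or.inl hne, rfl⟩
  have hk2 : ∀ j, (⟨k, j⟩ : Σ k, ZMod (m k)) ∈ C := fun j => by
    by_contra hne
    exact hk ⟨⟨k, j⟩, Or.inr hne, rfl⟩
  -- The image of the cycle follows the orbit of `⟨l, q⟩`. After `m k` steps it closes up, so `n l ∣
  -- m k`; after `n l` steps it is back at `⟨l, q⟩`, so injectivity gives `m k ∣ n l`.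
  obtain ⟨l, q, hq⟩ : ∃ l q, h ⟨k, 0⟩ = ⟨l, q⟩ := ⟨_, _, rfl⟩
  have hi : ∀ i : ℕ, h ⟨k, (i : ZMod (m k))⟩ = ⟨l, q + i⟩ := by
    intro i
    induction i with
    | zero => simpa using hq
    | succ i ih =>
      have := hk1 i
      rw [ih, blockShift_mk, blockShift_mk] at this
      push_cast
      rw [this, add_assoc]
  refine ⟨l, Nat.dvd_antisymm ?_ ?_⟩
  · have h1 := hi (m k)
    rw [ZMod.natCast_self, hq] at h1
    have h2 := eq_of_heq (Sigma.mk.inj_iff.1 h1).2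
    exact (ZMod.natCast_eq_zero_iff _ _).1 (left_eq_add.1 h2)
  · have h1 := hi (n l)
    rw [ZMod.natCast_self, add_zero, ← hq] at h1
    have h2 := eq_of_heq (Sigma.mk.inj_iff.1 (hinj (hk2 _) (hk2 _) h1)).2
    exact (ZMod.natCast_eq_zero_iff _ _).1 h2

theorem eventually_mem_range_of_allAutTrivial (hT : AllAutTrivial) {m n : ℕ → ℕ}
    (hm : ∀ k, 0 < m k) (hn : ∀ k, 0 < n k) (h : AreConjugate (blockAut m) (blockAut n)) :
    ∀ᶠ k in atTop, m k ∈ range n := by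
  obtain ⟨φ, hφ⟩ := h
  -- The conjugacy need not be an automorphism of `P(ℕ)/Fin`; the block enumerations turn it into
  -- one.
  obtain ⟨f, ⟨hfs, -⟩, hf⟩ := hT
    ((imageIso (blockEquiv hm)).symm.trans (φ.trans (imageIso (blockEquiv hn))))
  refine eventually_mem_range_of_induced hm hφ
    (h := fun p => (blockEquiv hn).symm (f (blockEquiv hm p)))
    (C := blockEquiv hm ⁻¹' f.source) ?_ ?_ fun A => ?_
  · rw [← preimage_compl]
    exact hfs.preimage (blockEquiv hm).injective.injOn
  · intro p hp q hq hpq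
    exact (blockEquiv hm).injective (f.injOn hp hq ((blockEquiv hn).symm.injective hpq))
  · have h1 := hf (blockEquiv hm '' A)
    rw [OrderIso.trans_apply, imageIso_symm_cls, (blockEquiv hm).preimage_image,
      OrderIso.trans_apply, ← OrderIso.eq_symm_apply, imageIso_symm_cls] at h1
    rw [h1, cls_eq_cls]
    constructor
    · refine finite_empty.subset ?_
      rintro p ⟨⟨_, ⟨⟨a, ha, rfl⟩, _⟩, hap⟩, hp⟩
      exact hp ⟨a, ha, (Equiv.symm_apply_eq _).2 hap⟩
    · refine ((hfs.preimage (blockEquiv hm).injective.injOn).image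
        fun p => (blockEquiv hn).symm (f (blockEquiv hm p))).subset ?_
      rintro _ ⟨⟨a, ha, rfl⟩, hp⟩
      refine ⟨a, fun has => hp ?_, rfl⟩
      exact ⟨_, ⟨⟨a, ha, rfl⟩, has⟩, ((blockEquiv hn).apply_symm_apply _).symm⟩

/-- Here the conjugacy is induced by a genuine bijection, so no triviality assumption enters. It
serves to show that distinct `x` give distinct automorphisms. -/
theorem eventually_mem_range_of_rotaryAut_eq {m n : ℕ → ℕ} (hm : ∀ k, 0 < m k)
    (hn : ∀ k, 0 < n k) (h : rotaryAut hm = rotaryAut hn) : ∀ᶠ k in atTop, m k ∈ range n := by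
  refine eventually_mem_range_of_induced hm
    (φ := (imageIso (blockEquiv hm)).trans (imageIso (blockEquiv hn)).symm)
    (h := fun p => (blockEquiv hn).symm (blockEquiv hm p)) (C := univ) (fun a => ?_) (by simp)
    (fun p _ q _ hpq => (blockEquiv hm).injective ((blockEquiv hn).symm.injective hpq)) fun A => ?_
  · rw [OrderIso.trans_apply, OrderIso.trans_apply, OrderIso.symm_apply_eq,
      imageIso_blockEquiv_blockAut, imageIso_blockEquiv_blockAut, OrderIso.apply_symm_apply, h]
  · rw [OrderIso.trans_apply, imageIso_cls, imageIso_symm_cls,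
      ← Equiv.image_symm_eq_preimage, image_image]

/-! ### An almost disjoint family -/

/-- The numbers whose binary expansions are a leading `1` followed by the initial segments of
`x`, the digits in the order of decreasing significance. -/
def branch (x : ℕ → Bool) : ℕ → ℕ
  | 0 => 1
  | k + 1 => 2 * branch x k + (x k).toNat

theorem branch_bounds (x : ℕ → Bool) (k : ℕ) : 2 ^ k ≤ branch x k ∧ branch x k < 2 ^ (k + 1) := by
  induction k with
  | zero => simp [branch]
  | succ k ih =>
    have := Bool.toNat_le (x k)
    rw [branch, pow_succ 2 (k + 1), pow_succ 2 k]
    rw [pow_succ 2 k] at ih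
    omega

theorem branch_strictMono (x : ℕ → Bool) : StrictMono (branch x) :=
  strictMono_nat_of_lt_succ fun k => by
    have := (branch_bounds x k).1.trans' Nat.one_le_two_pow
    rw [branch]
    omega

/-- The position of the leading binary digit determines the level. -/
theorem eq_of_branch_eq {x y : ℕ → Bool} {k l : ℕ} (h : branch x k = branch y l) : k = l := by
  have hx := branch_bounds x k
  have hy := branch_bounds y l
  have h1 := (Nat.pow_lt_pow_iff_right (a := 2) (by norm_num)).1 (hx.1.trans_lt (h ▸ hy.2))
  have h2 := (Nat.pow_lt_pow_iff_right (a := 2) (by norm_num)).1 (hy.1.trans_lt (h ▸ hx.2))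
  omega

theorem eq_below_of_branch_eq {x y : ℕ → Bool} {k : ℕ} (h : branch x k = branch y k) :
    ∀ i < k, x i = y i := by
  induction k with
  | zero => simp
  | succ k ih =>
    rw [branch, branch] at h
    have hx := Bool.toNat_le (x k)
    have hy := Bool.toNat_le (y k)
    intro i hi
    rcases Nat.lt_succ_iff_lt_or_eq.1 hi with hi | rfl
    · exact ih (by omega) i hi
    · cases hxi : x i <;> cases hyi : y i <;> simp [hxi, hyi] at h ⊢ <;> omega

theorem eq_of_eventually_mem_range_branch {x y : ℕ → Bool} {e : ℕ → ℕ} (he : StrictMono e)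
    (h : ∀ᶠ k in atTop, branch x (e k) ∈ range (branch y)) : x = y := by
  funext i
  obtain ⟨k, ⟨l, hl⟩, hk⟩ := (h.and (eventually_gt_atTop i)).exists
  obtain rfl := eq_of_branch_eq hl
  exact eq_below_of_branch_eq hl.symm i (hk.trans_le (he.le_apply))

end PModFin

/-! ### The family indexed by the Cantor space -/

theorem corollaryC :
    ∃ G : Set (PModFin.AutPFin ℕ),
      Cardinal.mk G = Cardinal.continuum ∧
      (∀ γ ∈ G, PModFin.IsTrivialAut γ ∧ PModFin.IsRotaryAut γ) ∧
      (PModFin.CH →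
        ∀ γ ∈ G, ∀ γ' ∈ G, ∀ (d d' : PModFin.PFin ℕ) (hd : γ d = d) (hd' : γ' d' = d'),
          d ≠ ⊥ → d' ≠ ⊥ →
            PModFin.AreConjugate
              (PModFin.restrictAut γ d hd) (PModFin.restrictAut γ' d' hd')) ∧
      (PModFin.AllAutTrivial →
        ∀ γ ∈ G, ∀ γ' ∈ G, γ ≠ γ' →
          ∀ (d d' : PModFin.PFin ℕ) (hd : γ d = d) (hd' : γ' d' = d'),
            d ≠ ⊥ → d' ≠ ⊥ →
              ¬ PModFin.AreConjugate
                (PModFin.restrictAut γ d hd) (PModFin.restrictAut γ' d' hd')) := by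
  obtain ⟨u, hu, hpos, hconv⟩ := PModFin.exists_strictMono_backForth PModFin.rotate
  have hx : ∀ (x : ℕ → Bool) (k : ℕ), 0 < (u ∘ PModFin.branch x) k := fun x k => hpos _
  have hmem : ∀ {x y : ℕ → Bool} {e : ℕ → ℕ}, StrictMono e →
      (∀ᶠ k in atTop, u (PModFin.branch x (e k)) ∈ range (u ∘ PModFin.branch y)) → x = y := by
    intro x y e he h
    refine PModFin.eq_of_eventually_mem_range_branch he (h.mono ?_)
    rintro k ⟨l, hl⟩
    exact ⟨l, hu.injective hl⟩
  have hinj : Function.Injective fun x => PModFin.rotaryAut (hx x) := fun x y hxy =>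
    hmem strictMono_id (PModFin.eventually_mem_range_of_rotaryAut_eq (hx x) (hx y) hxy)
  refine ⟨range fun x => PModFin.rotaryAut (hx x), ?_, ?_, ?_, ?_⟩
  · rw [Cardinal.mk_range_eq _ hinj]
    simp
  · rintro _ ⟨x, rfl⟩
    exact ⟨PModFin.isTrivialAut_rotaryAut _, PModFin.isRotaryAut_rotaryAut _⟩
  · rintro hCH _ ⟨x, rfl⟩ _ ⟨y, rfl⟩ d d' hd hd' hd0 hd0'
    obtain ⟨e, he, hconj⟩ := PModFin.exists_conjugate_restrictAut (hx x) d hd hd0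
    obtain ⟨e', he', hconj'⟩ := PModFin.exists_conjugate_restrictAut (hx y) d' hd' hd0'
    refine hconj.symm.trans (.trans (PModFin.blockAut_conjugate_of_CH hCH (fun k => hpos _)
      (fun k => hpos _) fun r => ?_) hconj')
    filter_upwards [eventually_ge_atTop r] with k hk
    -- Strictly increasing indices are at least `k`, so both lengths lie in the range where the
    -- types for `r` rounds have stabilized.
    exact hconv r _ _ (hk.trans (((PModFin.branch_strictMono x).comp he).le_apply))
      (hk.trans (((PModFin.branch_strictMono y).comp he').le_apply))
  · rintro hT _ ⟨x, rfl⟩ _ ⟨y, rfl⟩ hne d d' hd hd' hd0 hd0' h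
    obtain ⟨e, he, hconj⟩ := PModFin.exists_conjugate_restrictAut (hx x) d hd hd0
    obtain ⟨e', he', hconj'⟩ := PModFin.exists_conjugate_restrictAut (hx y) d' hd' hd0'
    refine hne (congrArg (fun x => PModFin.rotaryAut (hx x)) (hmem (y := y) he ?_))
    refine (PModFin.eventually_mem_range_of_allAutTrivial hT (fun k => hpos _) (fun k => hpos _)
      (hconj.trans (h.trans hconj'.symm))).mono ?_
    rintro k ⟨l, hl⟩
    exact ⟨e' l, hl⟩
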